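/- Let $U\subset\mathbf R^m$ be a convex open set and let $f:U\to\mathbf R^n$ be locally Lipschitz and tame, i.e. its graph, as a subset of $\mathbf R^{m+n}$, is either definable in some o-minimal structure on $(\mathbf R,+,\cdot,<)$ or subanalytic. (An o-minimal structure is a sequence of Boolean algebras $\mathcal O_k$ of subsets of $\mathbf R^k$, closed under products and under the projections $\mathbf R^{k+1}\to\mathbf R^k$, containing all real algebraic sets, and such that $\mathcal O_1$ consists exactly of the finite unions of intervals and points. A set $X\subset\mathbf R^k$ is semianalytic if every point of $\mathbf R^k$ has an open neighbourhood $W$ such that $X\cap W$ is a finite Boolean combination of sets $\{x\in W: g(x)=0\}$ and $\{x\in W: h(x)>0\}$ with $g,h$ real analytic on $W$; it is subanalytic if every point of $\mathbf R^k$ has an open neighbourhood $W$ such that $X\cap W$ is the projection of a bounded semianalytic subset of some $\mathbf R^{k+l}$.) Let $\mathcal D(f)$ be the set of the differentials $df(x)$, which are linear maps $\mathbf R^m\to\mathbf R^n$, at the points $x\in U$ where $f$ is differentiable, and let $\overline{co}(f)$ be the closed convex hull of $\mathcal D(f)$ in the space of linear maps. For $v\in\mathbf R^m$ with $|v|=1$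 put $\Sigma_v(f)=\{A\in\overline{co}(f): Av=0\}$. Assume: - $(C_e)$ for every $v\in\mathbf R^m$ with $|v|=1$, the set $\Sigma_v(f)$ is extremal in $\overline{co}(f)$, that is, whenever $A,B\in\overline{co}(f)$, $t\in(0,1)$ and $tA+(1-t)B\in\Sigma_v(f)$, then $A,B\in\Sigma_v(f)$; - $(S)$ $f$ is not constant on any segment $[x,y]\subset U$ with $x\neq y$. Then $f$ is injective. -/

import Mathlib

/-- An o-minimal structure on the ordered real field: for every `n` a Boolean algebra `Def n` of
subsets of `ℝⁿ` (the definable sets), stable under products and under the projections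
`ℝⁿ⁺¹ → ℝⁿ`, containing all algebraic sets, and such that the definable subsets of `ℝ` are exactly
the finite unions of intervals and points. -/
structure OMinimalStructure where
  /-- `Def n` is the family of definable subsets of `ℝⁿ`. -/
  Def : (n : ℕ) → Set (Set (Fin n → ℝ))
  empty_mem : ∀ n, ∅ ∈ Def n
  compl_mem : ∀ n, ∀ A ∈ Def n, Aᶜ ∈ Def n
  union_mem : ∀ n, ∀ A ∈ Def n, ∀ B ∈ Def n, A ∪ B ∈ Def n
  prod_mem : ∀ m n, ∀ A ∈ Def m, ∀ B ∈ Def n,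
    {z : Fin (m + n) → ℝ | (fun i => z (Fin.castAdd n i)) ∈ A ∧
      (fun j => z (Fin.natAdd m j)) ∈ B} ∈ Def (m + n)
  proj_mem : ∀ n, ∀ A ∈ Def (n + 1),
    (fun (z : Fin (n + 1) → ℝ) (i : Fin n) => z i.castSucc) '' A ∈ Def n
  algebraic_mem : ∀ n (p : MvPolynomial (Fin n) ℝ),
    {x : Fin n → ℝ | MvPolynomial.eval x p = 0} ∈ Def n
  /-- The order-connected subsets of `ℝ` are the intervals of all kinds, bounded or not, including
  the empty set and the one-point sets. -/
  def_one_iff : ∀ A : Set (Fin 1 → ℝ), A ∈ Def 1 ↔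
    ∃ F : Set (Set ℝ), F.Finite ∧ (∀ I ∈ F, I.OrdConnected) ∧ A = {x | x 0 ∈ ⋃₀ F}

/-- The finite Boolean combinations, inside the set `U ⊆ ℝⁿ`, of the sets `{x ∈ U | g x = 0}` and
`{x ∈ U | g x > 0}` with `g` real analytic on `U`. -/
inductive IsAnalyticCombination {n : ℕ} (U : Set (Fin n → ℝ)) : Set (Fin n → ℝ) → Prop
  | eq_zero (g : (Fin n → ℝ) → ℝ) (hg : AnalyticOnNhd ℝ g U) :
      IsAnalyticCombination U {x | x ∈ U ∧ g x = 0}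
  | pos (g : (Fin n → ℝ) → ℝ) (hg : AnalyticOnNhd ℝ g U) :
      IsAnalyticCombination U {x | x ∈ U ∧ 0 < g x}
  | compl (A : Set (Fin n → ℝ)) (hA : IsAnalyticCombination U A) :
      IsAnalyticCombination U (U \ A)
  | union (A B : Set (Fin n → ℝ)) (hA : IsAnalyticCombination U A)
      (hB : IsAnalyticCombination U B) : IsAnalyticCombination U (A ∪ B)

/-- Semianalytic subsets of `ℝⁿ`. -/
def IsSemianalytic {n : ℕ} (X : Set (Fin n → ℝ)) : Prop :=
  ∀ x : Fin n → ℝ, ∃ U : Set (Fin n → ℝ), IsOpen U ∧ x ∈ U ∧ IsAnalyticCombination U (X ∩ U)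

/-- Subanalytic subsets of `ℝⁿ`: near every point of `ℝⁿ` the set is the projection of a bounded
semianalytic subset of some `ℝⁿ⁺ᵏ`. -/
def IsSubanalytic {n : ℕ} (X : Set (Fin n → ℝ)) : Prop :=
  ∀ x : Fin n → ℝ, ∃ U : Set (Fin n → ℝ), IsOpen U ∧ x ∈ U ∧
    ∃ (k : ℕ) (Y : Set (Fin (n + k) → ℝ)), Bornology.IsBounded Y ∧ IsSemianalytic Y ∧
      X ∩ U = (fun (y : Fin (n + k) → ℝ) (i : Fin n) => y (Fin.castAdd k i)) '' Y

/-- The graph of `f : U → ℝⁿ`, `U ⊆ ℝᵐ`, as a subset of `ℝᵐ⁺ⁿ`. -/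
def graphSet {m n : ℕ} (U : Set (EuclideanSpace ℝ (Fin m)))
    (f : EuclideanSpace ℝ (Fin m) → EuclideanSpace ℝ (Fin n)) : Set (Fin (m + n) → ℝ) :=
  {z | ∃ x ∈ U, z = Fin.append (fun i => x i) (fun j => f x j)}

/-- `f : U → ℝⁿ` is tame: its graph is definable in some o-minimal structure on the ordered real
field, or subanalytic. -/
def IsTame {m n : ℕ} (U : Set (EuclideanSpace ℝ (Fin m)))
    (f : EuclideanSpace ℝ (Fin m) → EuclideanSpace ℝ (Fin n)) : Prop :=
  (∃ O : OMinimalStructure, graphSet U f ∈ O.Def (m + n)) ∨ IsSubanalytic (graphSet U f)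

/-- The set `𝒟(f)` of the differentials of `f` at the points of `U` where `f` is differentiable;
matrices are identified with linear maps `ℝᵐ → ℝⁿ`. (The set `U` is open where this is used.) -/
def jacobianSet {m n : ℕ} (U : Set (EuclideanSpace ℝ (Fin m)))
    (f : EuclideanSpace ℝ (Fin m) → EuclideanSpace ℝ (Fin n)) :
    Set (EuclideanSpace ℝ (Fin m) →L[ℝ] EuclideanSpace ℝ (Fin n)) :=
  {A | ∃ x ∈ U, DifferentiableAt ℝ f x ∧ A = fderiv ℝ f x}

/-- The closed convex hull of `𝒟(f)`. -/
def coBar {m n : ℕ} (U : Set (EuclideanSpace ℝ (Fin m)))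
    (f : EuclideanSpace ℝ (Fin m) → EuclideanSpace ℝ (Fin n)) :
    Set (EuclideanSpace ℝ (Fin m) →L[ℝ] EuclideanSpace ℝ (Fin n)) :=
  closedConvexHull ℝ (jacobianSet U f)

/-- `Σ_v(f)`: the elements of the closed convex hull of `𝒟(f)` that kill `v`. -/
def sigmaSet {m n : ℕ} (U : Set (EuclideanSpace ℝ (Fin m)))
    (f : EuclideanSpace ℝ (Fin m) → EuclideanSpace ℝ (Fin n)) (v : EuclideanSpace ℝ (Fin m)) :
    Set (EuclideanSpace ℝ (Fin m) →L[ℝ] EuclideanSpace ℝ (Fin n)) :=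
  {A | A v = 0} ∩ coBar U f

/-!
The theorem follows from the mean value theorem for
Lipschitz maps: for `x, y ∈ U` there is `A` in the closed convex hull of the differentials with
`f y - f x = A (y - x)` (`exists_mem_coBar_apply_eq_sub`).

Suppose `f x = f y` with `x ≠ y`, and let `z = x + t (y - x)` with `0 < t < 1`. Choose `A` for the
segment `[x, z]` and `B` for `[z, y]`. Then `t A + (1 - t) B` lies in the closed convex hull and
maps `y - x` to `(f z - f x) + (f y - f z) = 0`. By extremality `A` already kills `y - x`, so
`f z = f x`. Hence `f` is constant on `[x, y]`, which is excluded.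

The mean value theorem is reduced by Hahn–Banach separation to a bound for real-valued Lipschitz
functions (`LipschitzOnWith.sub_le_of_ae_fderiv_apply_le`): if `Dg(z)(y - x) ≤ c` for almost every
`z`, then `g y - g x ≤ c`. The segment `[x, y]` itself may avoid the points of differentiability, but by
Rademacher's and Fubini's theorems almost every small translate of it meets the exceptional set in
a null set, and the fundamental theorem of calculus applies there.
-/

open MeasureTheory Set Filter Topology
open scoped NNReal

/-! ### A mean value inequality for Lipschitz functions -/

theorem LipschitzOnWith.sub_le_of_ae_deriv_le {h : ℝ → ℝ} {C : ℝ≥0}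
    (hh : LipschitzOnWith C h (Icc 0 1)) {c : ℝ}
    (hc : ∀ᵐ t : ℝ, t ∈ Ioo (0 : ℝ) 1 → deriv h t ≤ c) : h 1 - h 0 ≤ c := by
  have hac : AbsolutelyContinuousOnInterval h 0 1 := by
    apply LipschitzOnWith.absolutelyContinuousOnInterval (K := C)
    rwa [uIcc_of_le zero_le_one]
  rw [← hac.integral_deriv_eq_sub]
  have key : ∫ t in (0 : ℝ)..1, deriv h t ≤ ∫ _t in (0 : ℝ)..1, c := by
    rw [intervalIntegral.integral_of_le zero_le_one, intervalIntegral.integral_of_le zero_le_one,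
      integral_Ioc_eq_integral_Ioo, integral_Ioc_eq_integral_Ioo]
    refine setIntegral_mono_on_ae ?_ (by simp) measurableSet_Ioo ?_
    · exact ((intervalIntegrable_iff_integrableOn_Ioc_of_le zero_le_one).1
        hac.intervalIntegrable_deriv).mono_set Ioo_subset_Ioc_self
    · exact hc
  simpa using key

section

variable {E : Type*} [NormedAddCommGroup E] [NormedSpace ℝ E]

theorem lipschitzOnWith_comp_add_smul {g : E → ℝ} {V : Set E} {C : ℝ≥0}
    (hg : LipschitzOnWith C g V) {p w : E} (hp : ∀ t ∈ Icc (0 : ℝ) 1, p + t • w ∈ V) :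
    LipschitzOnWith (C * ‖w‖₊) (fun t : ℝ => g (p + t • w)) (Icc 0 1) := by
  refine LipschitzOnWith.of_dist_le_mul fun s hs t ht => ?_
  refine (hg.dist_le_mul _ (hp s hs) _ (hp t ht)).trans (le_of_eq ?_)
  rw [dist_add_left, dist_eq_norm, ← sub_smul, norm_smul, Real.dist_eq, Real.norm_eq_abs]
  push_cast
  ring

variable [FiniteDimensional ℝ E]

/-- Fubini's theorem for lines: almost every translate of a line meets a null set in a null set. -/
theorem ae_ae_add_smul_of_ae [MeasurableSpace E] [BorelSpace E] {μ : Measure E}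
    [μ.IsAddHaarMeasure] {P : E → Prop} (hP : ∀ᵐ z ∂μ, P z) (x w : E) :
    ∀ᵐ u ∂μ, ∀ᵐ t : ℝ, P (x + u + t • w) := by
  obtain ⟨N, hPN, hN, hN0⟩ := exists_measurable_superset_of_null (ae_iff.1 hP)
  have hmeas : Measurable fun q : E × ℝ => x + q.1 + q.2 • w := by fun_prop
  have h : ∀ᵐ u ∂μ, ∀ᵐ t : ℝ, x + u + t • w ∉ N := by
    rw [Measure.ae_ae_comm (p := fun u (t : ℝ) => x + u + t • w ∉ N) (hmeas hN).compl]
    refine Eventually.of_forall fun t => ?_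
    rw [ae_iff]
    have : {u | ¬ x + u + t • w ∉ N} = (fun u => (x + t • w) + u) ⁻¹' N := by
      ext u
      simp only [not_not, mem_ofPred_eq, mem_preimage]
      rw [add_right_comm]
    rw [this, measure_preimage_add, hN0]
  filter_upwards [h] with u hu
  filter_upwards [hu] with t ht
  by_contra hcon
  exact ht (hPN hcon)

/-- The mean value inequality for a Lipschitz function whose differentials are controlled only
almost everywhere; the segment from `x` to `y` may lie entirely in the exceptional null set. -/
theorem LipschitzOnWith.sub_le_of_ae_fderiv_apply_le [MeasurableSpace E] [BorelSpace E]
    {μ : Measure E} [μ.IsAddHaarMeasure] {g : E → ℝ} {V : Set E} {C : ℝ≥0} (hV : IsOpen V)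
    (hVc : Convex ℝ V) (hg : LipschitzOnWith C g V) {x y : E} (hx : x ∈ V) (hy : y ∈ V) {c : ℝ}
    (hc : ∀ᵐ z ∂μ, z ∈ V → fderiv ℝ g z (y - x) ≤ c) : g y - g x ≤ c := by
  have hdiff : ∀ᵐ z ∂μ, z ∈ V → DifferentiableAt ℝ g z ∧ fderiv ℝ g z (y - x) ≤ c := by
    filter_upwards [hg.ae_differentiableWithinAt_of_mem (μ := μ), hc] with z hz hcz hzV
    exact ⟨(hz hzV).differentiableAt (hV.mem_nhds hzV), hcz hzV⟩
  have htr : ∀ p : E, Tendsto (fun u : E => p + u) (𝓝 0) (𝓝 p) := fun p => by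
    simpa using (continuous_const_add p).tendsto 0
  -- The inequality holds for almost every small translate of `x` and `y`, and `g` is continuous.
  have hle : ∃ᶠ u in 𝓝 (0 : E), g (y + u) - g (x + u) ≤ c := by
    have hdense := Measure.dense_of_ae (ae_ae_add_smul_of_ae hdiff x (y - x)) 0
    refine ((mem_closure_iff_frequently.1 hdense).and_eventually
      (((htr x).eventually_mem (hV.mem_nhds hx)).and
        ((htr y).eventually_mem (hV.mem_nhds hy)))).mono ?_
    rintro u ⟨hu, hxu, hyu⟩
    have hseg : ∀ t ∈ Icc (0 : ℝ) 1, x + u + t • (y - x) ∈ V := fun t ht => by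
      have := hVc.add_smul_sub_mem hxu hyu ht
      rwa [add_sub_add_right_eq_sub] at this
    have key := (lipschitzOnWith_comp_add_smul hg hseg).sub_le_of_ae_deriv_le (c := c) (by
      filter_upwards [hu] with t ht ht01
      have hz := hseg t (Ioo_subset_Icc_self ht01)
      obtain ⟨hd, hle⟩ := ht hz
      have hline : HasDerivAt (fun s : ℝ => x + u + s • (y - x)) (y - x) t := by
        simpa using ((hasDerivAt_id t).smul_const (y - x)).const_add (x + u)
      have := hd.hasFDerivAt.comp_hasDerivAt t hline
      rw [show deriv (fun s : ℝ => g (x + u + s • (y - x))) t = _ from this.deriv]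
      exact hle)
    have e : x + u + (y - x) = y + u := by abel
    simpa [e] using key
  refine le_of_tendsto_of_frequently ?_ hle
  exact ((hg.continuousOn.continuousAt (hV.mem_nhds hy)).tendsto.comp (htr y)).sub
    ((hg.continuousOn.continuousAt (hV.mem_nhds hx)).tendsto.comp (htr x))

end

/-! ### The mean value theorem in the closed convex hull of the differentials -/

section

variable {m n : ℕ}

theorem isCompact_coBar {V : Set (EuclideanSpace ℝ (Fin m))}
    {f : EuclideanSpace ℝ (Fin m) → EuclideanSpace ℝ (Fin n)} {C : ℝ≥0} (hV : IsOpen V)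
    (hf : LipschitzOnWith C f V) : IsCompact (coBar V f) := by
  refine (isCompact_closedBall 0 (C : ℝ)).of_isClosed_subset isClosed_closedConvexHull ?_
  refine closedConvexHull_min ?_ (convex_closedBall _ _) Metric.isClosed_closedBall
  rintro A ⟨z, hz, -, rfl⟩
  rw [mem_closedBall_zero_iff]
  exact norm_fderiv_le_of_lipschitzOn ℝ (hV.mem_nhds hz) hf

/-- The mean value theorem on a convex open set where the map is Lipschitz. -/
theorem LipschitzOnWith.exists_mem_coBar_apply_eq_sub {V : Set (EuclideanSpace ℝ (Fin m))}
    {f : EuclideanSpace ℝ (Fin m) → EuclideanSpace ℝ (Fin n)} {C : ℝ≥0} (hV : IsOpen V)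
    (hVc : Convex ℝ V) (hf : LipschitzOnWith C f V) {x y : EuclideanSpace ℝ (Fin m)}
    (hx : x ∈ V) (hy : y ∈ V) : ∃ A ∈ coBar V f, A (y - x) = f y - f x := by
  let ev := ContinuousLinearMap.apply ℝ (EuclideanSpace ℝ (Fin n)) (y - x)
  suffices h : f y - f x ∈ ev '' coBar V f from h
  by_contra hnot
  have hconv : Convex ℝ (ev '' coBar V f) :=
    convex_closedConvexHull.linear_image ev.toLinearMap
  obtain ⟨l, c, hlt, hgt⟩ := geometric_hahn_banach_closed_point hconv
    ((isCompact_coBar hV hf).image ev.continuous).isClosed hnot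
  have hlf : LipschitzOnWith (‖l‖₊ * C) (fun z => l (f z)) V := l.lipschitz.comp_lipschitzOnWith hf
  have hle := hlf.sub_le_of_ae_fderiv_apply_le (μ := volume) hV hVc hx hy (c := c) (by
    filter_upwards [hf.ae_differentiableWithinAt_of_mem (μ := volume)] with z hz hzV
    have hd := (hz hzV).differentiableAt (hV.mem_nhds hzV)
    have hfd : HasFDerivAt (fun z => l (f z)) (l ∘L fderiv ℝ f z) z :=
      l.hasFDerivAt.comp z hd.hasFDerivAt
    rw [hfd.fderiv]
    exact (hlt _ ⟨_, subset_closedConvexHull ⟨z, hzV, hd, rfl⟩, rfl⟩).le)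
  rw [map_sub] at hgt
  exact hgt.not_ge hle

/-- The mean value theorem for locally Lipschitz maps on a convex open set. -/
theorem exists_mem_coBar_apply_eq_sub {U : Set (EuclideanSpace ℝ (Fin m))}
    {f : EuclideanSpace ℝ (Fin m) → EuclideanSpace ℝ (Fin n)} (hU : IsOpen U)
    (hUc : Convex ℝ U) (hf : LocallyLipschitzOn U f) {x y : EuclideanSpace ℝ (Fin m)}
    (hx : x ∈ U) (hy : y ∈ U) : ∃ A ∈ coBar U f, A (y - x) = f y - f x := by
  have hcomp : IsCompact (segment ℝ x y) := by
    rw [segment_eq_image_lineMap]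
    exact isCompact_Icc.image AffineMap.lineMap_continuous
  obtain ⟨δ, hδ, hsub⟩ := hcomp.exists_cthickening_subset_open hU (hUc.segment_subset hx hy)
  obtain ⟨C, hC⟩ := (hf.mono hsub).exists_lipschitzOnWith_of_compact hcomp.cthickening
  have hle := Metric.thickening_subset_cthickening δ (segment ℝ x y)
  have hmem := Metric.self_subset_thickening hδ (segment ℝ x y)
  obtain ⟨A, hA, hAe⟩ := (hC.mono hle).exists_mem_coBar_apply_eq_sub Metric.isOpen_thickening
    ((convex_segment x y).thickening δ) (hmem (left_mem_segment ℝ x y))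
    (hmem (right_mem_segment ℝ x y))
  refine ⟨A, (closedConvexHull (𝕜 := ℝ)).monotone ?_ hA, hAe⟩
  rintro B ⟨z, hz, hB⟩
  exact ⟨z, hsub (hle hz), hB⟩

/-! ### Injectivity -/

/-- The only use of extremality: the mean value matrices of `[x, z]` and `[z, y]` have a convex
combination that kills `y - x`, so each of them does. -/
theorem eq_on_segment_of_isExtreme_sigmaSet {U : Set (EuclideanSpace ℝ (Fin m))}
    {f : EuclideanSpace ℝ (Fin m) → EuclideanSpace ℝ (Fin n)} (hU : IsOpen U)
    (hUc : Convex ℝ U) (hf : LocallyLipschitzOn U f)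
    (hCe : ∀ v : EuclideanSpace ℝ (Fin m), ‖v‖ = 1 → IsExtreme ℝ (coBar U f) (sigmaSet U f v))
    {x y : EuclideanSpace ℝ (Fin m)} (hx : x ∈ U) (hy : y ∈ U) (hxy : f x = f y) :
    ∀ z ∈ segment ℝ x y, f z = f x := by
  intro z hz
  rcases eq_or_ne x y with rfl | hne
  · rw [segment_same] at hz
    rw [mem_singleton_iff.1 hz]
  have hzU := hUc.segment_subset hx hy hz
  rw [segment_eq_image'] at hz
  obtain ⟨t, ⟨ht0, ht1⟩, rfl⟩ := hz
  rcases ht0.eq_or_lt with rfl | ht0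
  · simp
  rcases ht1.eq_or_lt with rfl | ht1
  · simp [hxy]
  obtain ⟨A, hA, hAe⟩ := exists_mem_coBar_apply_eq_sub hU hUc hf hx hzU
  obtain ⟨B, hB, hBe⟩ := exists_mem_coBar_apply_eq_sub hU hUc hf hzU hy
  beta_reduce at hAe hBe ⊢
  have hw : ‖y - x‖ ≠ 0 := norm_ne_zero_iff.2 (sub_ne_zero.2 hne.symm)
  rw [add_sub_cancel_left, map_smul] at hAe
  rw [show y - (x + t • (y - x)) = (1 - t) • (y - x) by module, map_smul] at hBe
  have hmem : t • A + (1 - t) • B ∈ sigmaSet U f (‖y - x‖⁻¹ • (y - x)) := by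
    refine ⟨?_, convex_closedConvexHull hA hB ht0.le (sub_nonneg.2 ht1.le) (by ring)⟩
    have h : (t • A + (1 - t) • B) (y - x) = 0 := by
      rw [_root_.add_apply, _root_.smul_apply,
        _root_.smul_apply, hAe, hBe, hxy]
      abel
    rw [mem_ofPred_eq, map_smul, h, smul_zero]
  have hAS := (hCe _ (by rw [norm_smul, norm_inv, norm_norm, inv_mul_cancel₀ hw])).2 hA hB hmem
    ⟨t, 1 - t, ht0, sub_pos.2 ht1, by ring, rfl⟩
  have hA0 : A (y - x) = 0 := by
    have h : A (‖y - x‖⁻¹ • (y - x)) = 0 := hAS.1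
    rw [map_smul] at h
    exact (smul_eq_zero.1 h).resolve_left (inv_ne_zero hw)
  rw [hA0, smul_zero] at hAe
  exact sub_eq_zero.1 hAe.symm

end

theorem theorem3p4 {m n : ℕ} (U : Set (EuclideanSpace ℝ (Fin m)))
    (hU_open : IsOpen U) (hU_convex : Convex ℝ U)
    (f : EuclideanSpace ℝ (Fin m) → EuclideanSpace ℝ (Fin n))
    (hf_lip : LocallyLipschitzOn U f) (hf_tame : IsTame U f)
    (hCe : ∀ v : EuclideanSpace ℝ (Fin m), ‖v‖ = 1 →
      IsExtreme ℝ (coBar U f) (sigmaSet U f v))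
    (hS : ∀ x ∈ U, ∀ y ∈ U, x ≠ y → ¬ ∃ c, ∀ z ∈ segment ℝ x y, f z = c) :
    Set.InjOn f U := by
  intro x hx y hy hxy
  by_contra hne
  exact hS x hx y hy hne
    ⟨f x, eq_on_segment_of_isExtreme_sigmaSet hU_open hU_convex hf_lip hCe hx hy hxy⟩
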